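/- Let $q\ge 2$ and let $\alpha_{\infty,1},\dots,\alpha_{\infty,q}$ be non-zero, pairwise distinct real numbers. There exists a constant $C>0$, depending only on $q$ and $\alpha_{\infty,1},\dots,\alpha_{\infty,q}$, with the following property. Let $F_\infty=\sum_{i=1}^q\alpha_{\infty,i}(N_i^2-1)$ with $N_1,\dots,N_q$ i.i.d. $\mathscr N(0,1)$, and let $(F_n)_n$ be a sequence of elements of the second Wiener chaos, written $$F_n=\sum_{k\ge1}\alpha_{n,k}\,(N_{n,k}^2-1),$$ where for each $n$ the variables $(N_{n,k})_{k\ge1}$ are i.i.d. $\mathscr N(0,1)$ (on a common probability space), $\alpha_{n,k}\in\mathbb R$, and the series converges in $L^2$. Assume the normalization $\mathbb E[F_n^2]=\mathbb E[F_\infty^2]$ for all $n$ (for instance, both equal to $1$). Put $$\Delta(F_n)=\sum_{k\ge1}\alpha_{n,k}^2\prod_{r=1}^q(\alpha_{n,k}-\alpha_{\infty,r})^2,\qquad \Delta(F_\infty)=\sum_{i=1}^q\alpha_{\infty,i}^2\prod_{r=1}^q(\alpha_{\infty,i}-\alpha_{\infty,r})^2,$$ let $\kappa_r(F)=\frac{d^r}{dt^r}\log\mathbb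 E[e^{tF}]\big|_{t=0}$ be the $r$-th cumulant of $F$, and let $W_2(F,G)=\inf_\pi\big(\int|x-y|^2\,d\pi(x,y)\big)^{1/2}$, the infimum being over all couplings $\pi$ of the laws of $F$ and $G$. Then: (a) for all $n$, $$W_2(F_n,F_\infty)\le C\Big(\sqrt{\Delta(F_n)}+\sum_{r=2}^{q+1}|\kappa_r(F_n)-\kappa_r(F_\infty)|\Big);$$ (b) if moreover $\dim_{\mathbb Q}\operatorname{span}_{\mathbb Q}\{\alpha_{\infty,1}^2,\dots,\alpha_{\infty,q}^2\}=q$, then $W_2(F_n,F_\infty)\le C\sqrt{\Delta(F_n)}$ for all $n$. Moreover $\Delta(F_\infty)=0$ and, in this case, the sole convergence $\Delta(F_n)\to\Delta(F_\infty)=0$ implies that $F_n$ converges in distribution to $F_\infty$. -/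

import Mathlib

open MeasureTheory ProbabilityTheory Filter Topology
open scoped ENNReal

noncomputable section

/-- The Wasserstein distance of order `p` between two measures on the real line: the infimum of
`(∫ |x - y| ^ p dπ) ^ (1 / p)` over all couplings `π`, with values in `[0, ∞]`. -/
def wassersteinDist (p : ℝ) (μ ν : Measure ℝ) : ℝ≥0∞ :=
  (⨅ π ∈ {π : Measure (ℝ × ℝ) | π.map Prod.fst = μ ∧ π.map Prod.snd = ν},
    ∫⁻ z, edist z.1 z.2 ^ p ∂π) ^ (1 / p)

/-- The `r`-th cumulant of a real random variable having finite exponential moments near `0`: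
the `r`-th derivative at `0` of `t ↦ log E[exp (t X)]`. -/
def cumulant {Ω : Type*} [MeasurableSpace Ω] (r : ℕ) (X : Ω → ℝ) (P : Measure Ω) : ℝ :=
  iteratedDeriv r (cgf X P) 0

/-- `N` is a family of independent standard Gaussian random variables. -/
structure IsStdGaussianFamily {Ω ι : Type*} [MeasurableSpace Ω] (N : ι → Ω → ℝ)
    (P : Measure Ω) : Prop where
  hasLaw : ∀ k, HasLaw (N k) (gaussianReal 0 1) P
  indep : iIndepFun N P

/-- `F = ∑ₖ αₖ (Nₖ² - 1)`, the series being convergent in `L²(P)`. -/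
structure IsSecondChaosSeries {Ω : Type*} [MeasurableSpace Ω] (F : Ω → ℝ) (α : ℕ → ℝ)
    (N : ℕ → Ω → ℝ) (P : Measure Ω) : Prop where
  memLp : MemLp F 2 P
  tendsto : Tendsto
    (fun m : ℕ => eLpNorm
      (fun ω => F ω - ∑ k ∈ Finset.range m, α k * (N k ω ^ 2 - 1)) 2 P) atTop (𝓝 0)

/-- The discrepancy `Δ(F) = ∑ₖ αₖ² ∏ᵣ (αₖ - aᵣ)²` of `F = ∑ₖ αₖ (Nₖ² - 1)` relative to the target
with coefficients `a`. The index set of the coefficients `α` may be finite or infinite. -/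
def chaosDelta {q : ℕ} {ι : Type*} (a : Fin q → ℝ) (α : ι → ℝ) : ℝ :=
  ∑' k, α k ^ 2 * ∏ r, (α k - a r) ^ 2

end

/-! Everything reduces to the coefficient sequences. Assign to each `α k` the nearest point `ρ k` of
`{0, a 1, …, a q}`. The polynomial `x² ∏ (x - a r)²` has these points as its double roots, so it
dominates the squared distance to the nearest one, and `∑ (α k - ρ k)² ≤ Δ / c`.

Let `m r + 1` be the number of indices assigned to `a r`. If `m = 0`, then `ρ` is a rearrangement of
`a` padded with zeros; pairing each `a r` with the Gaussian at its index couples the two laws at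
squared cost `2 ∑ (α k - ρ k)²`. If `m ≠ 0`, the trivial bound on the distance suffices, because the
right-hand side cannot be small. Indeed `m` lies in a finite set of integer vectors fixed by `a`,
and some `∑ m r * a r ^ j` is nonzero, hence bounded below, whereas it is at most the difference of
the `j`-th power sums of `α` and `a` plus a multiple of `√Δ` (`exists_embedding_sqrt_le`).

For (a), the exponents `2, …, q + 1` detect `m ≠ 0` by Vandermonde, and power sums are cumulants up
to a factor (`IsSecondChaosSeries.cumulant_eq`). For (b), rational independence makes `j = 2`
enough, and the normalization equates the second power sums. -/

/-! ### Elementary estimates on coefficients, roots and power sums. -/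

theorem exists_pos_forall_le {ι : Type*} {s : Set ι} (hs : s.Finite) {f : ι → ℝ}
    (hf : ∀ i ∈ s, 0 < f i) : ∃ d > 0, ∀ i ∈ s, d ≤ f i := by
  have h : ∀ᶠ d in 𝓝[>] (0 : ℝ), ∀ i ∈ s, d ≤ f i := by
    rw [Filter.eventually_all_finite hs]
    intro i hi
    exact (eventually_le_nhds (hf i hi)).filter_mono nhdsWithin_le_nhds
  obtain ⟨d, hd, hd'⟩ := (h.and self_mem_nhdsWithin).exists
  exact ⟨d, hd', hd⟩

/-- A monic split polynomial with simple roots controls the distance to the nearest root. -/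
theorem exists_nearest_root {ι : Type*} [Fintype ι] [Nonempty ι] {b : ι → ℝ}
    (hb : Function.Injective b) :
    ∃ c > 0, ∀ x : ℝ, ∃ o, (∀ o', |x - b o| ≤ |x - b o'|) ∧
      c * (x - b o) ^ 2 ≤ ∏ o', (x - b o') ^ 2 := by
  classical
  obtain ⟨d, hd, hdb⟩ := exists_pos_forall_le (s := {p : ι × ι | p.1 ≠ p.2}) (Set.toFinite _)
    (f := fun p => |b p.1 - b p.2|) (fun p hp => abs_pos.2 (sub_ne_zero.2 (hb.ne hp)))
  -- With `d` the least gap between roots, every root other than the nearest one is at distance at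
  -- least `d / 2` from `x`.
  refine ⟨((d / 2) ^ 2) ^ (Fintype.card ι - 1), by positivity, fun x => ?_⟩
  obtain ⟨o, ho⟩ := Finite.exists_min (fun o => |x - b o|)
  refine ⟨o, ho, ?_⟩
  rw [← Finset.prod_erase_mul _ _ (Finset.mem_univ o)]
  refine mul_le_mul_of_nonneg_right ?_ (sq_nonneg _)
  have hcard : (Finset.univ.erase o).card = Fintype.card ι - 1 := by
    rw [Finset.card_erase_of_mem (Finset.mem_univ o), Finset.card_univ]
  rw [← hcard, ← Finset.prod_const]
  refine Finset.prod_le_prod (fun _ _ => by positivity) fun o' ho' => ?_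
  have hne : o ≠ o' := (Finset.ne_of_mem_erase ho').symm
  have h1 : d ≤ |b o - b o'| := hdb (o, o') hne
  have h2 : |b o - b o'| ≤ |x - b o| + |x - b o'| := by
    rw [abs_sub_comm x (b o)]
    exact (abs_sub_le _ x _)
  rw [← sq_abs (x - b o')]
  have := ho o'
  exact pow_le_pow_left₀ (by positivity) (by linarith) 2

/-- Factor out `x - y` by the geometric sum. One factor `|x|` is kept outside `R`, so that
Cauchy–Schwarz applies after summation over the coefficients. -/
theorem abs_pow_sub_pow_le_of_abs_le {x y R : ℝ} (hx : |x| ≤ R) (hy : |y| ≤ 2 * |x|) {j : ℕ} (hj : 2 ≤ j) :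
    |x ^ j - y ^ j| ≤ j * 2 ^ (j - 1) * R ^ (j - 2) * (|x - y| * |x|) := by
  have h0 := abs_nonneg x
  rw [← (Commute.all x y).geom_sum₂_mul, abs_mul]
  have h : |∑ i ∈ Finset.range j, x ^ i * y ^ (j - 1 - i)| ≤ j * (2 ^ (j - 1) * |x| ^ (j - 1)) := by
    refine (Finset.abs_sum_le_sum_abs _ _).trans ?_
    refine (Finset.sum_le_card_nsmul _ _ (2 ^ (j - 1) * |x| ^ (j - 1)) fun i hi => ?_).trans (by simp)
    have hi' : i ≤ j - 1 := by have := Finset.mem_range.1 hi; omega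
    rw [abs_mul, abs_pow, abs_pow]
    calc |x| ^ i * |y| ^ (j - 1 - i) ≤ (2 * |x|) ^ i * (2 * |x|) ^ (j - 1 - i) := by
          gcongr
          linarith
      _ = 2 ^ (j - 1) * |x| ^ (j - 1) := by
          rw [← pow_add, Nat.add_sub_cancel' hi', mul_pow]
  have h2 : |x| ^ (j - 1) ≤ R ^ (j - 2) * |x| := by
    have : j - 1 = (j - 2) + 1 := by omega
    rw [this, pow_succ]
    gcongr
  calc _ ≤ (j * (2 ^ (j - 1) * (R ^ (j - 2) * |x|))) * |x - y| := by
        gcongr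
        exact h.trans (by gcongr)
    _ = _ := by ring

theorem summable_mul_and_tsum_mul_le_sqrt_mul_sqrt {u v : ℕ → ℝ} (hu : Summable fun k => u k ^ 2)
    (hv : Summable fun k => v k ^ 2) :
    (Summable fun k => |u k| * |v k|) ∧
      ∑' k, |u k| * |v k| ≤ √(∑' k, u k ^ 2) * √(∑' k, v k ^ 2) := by
  have h := Real.summable_and_inner_le_Lp_mul_Lq_tsum_of_nonneg
    (f := fun k => |u k|) (g := fun k => |v k|) Real.HolderConjugate.two_two
    (fun _ => abs_nonneg _) (fun _ => abs_nonneg _) (by simpa using hu) (by simpa using hv)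
  simpa [Real.sqrt_eq_rpow] using h

theorem Function.extend_zero_pow {ι κ : Type*} (k : ι ↪ κ) (a : ι → ℝ) {j : ℕ} (hj : j ≠ 0) (i : κ) :
    Function.extend k a 0 i ^ j = Function.extend k (fun r => a r ^ j) 0 i := by
  by_cases h : ∃ r, k r = i
  · obtain ⟨r, rfl⟩ := h
    simp [k.injective.extend_apply]
  · simp [Function.extend_apply' _ _ _ h, hj]

theorem hasSum_extend_pow {ι κ : Type*} [Fintype ι] (k : ι ↪ κ) (a : ι → ℝ) {j : ℕ} (hj : j ≠ 0) :
    HasSum (fun i => Function.extend k a 0 i ^ j) (∑ r, a r ^ j) := by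
  simp_rw [Function.extend_zero_pow k a hj]
  rw [show (fun i => Function.extend k (fun r => a r ^ j) 0 i)
    = Function.extend k (fun r => a r ^ j) 0 from rfl, hasSum_extend_zero k.injective]
  exact hasSum_fintype _

theorem summable_sq_sub {u v : ℕ → ℝ} (hu : Summable fun k => u k ^ 2)
    (hv : Summable fun k => v k ^ 2) :
    (Summable fun k => (u k - v k) ^ 2) ∧
      ∑' k, (u k - v k) ^ 2 ≤ 2 * ∑' k, u k ^ 2 + 2 * ∑' k, v k ^ 2 := by
  have hle : ∀ k, (u k - v k) ^ 2 ≤ 2 * u k ^ 2 + 2 * v k ^ 2 := fun k => by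
    nlinarith [sq_nonneg (u k + v k)]
  have hs := (hu.mul_left 2).add (hv.mul_left 2)
  have hs' := Summable.of_nonneg_of_le (fun _ => sq_nonneg _) hle hs
  refine ⟨hs', ?_⟩
  rw [← tsum_mul_left, ← tsum_mul_left, ← (hu.mul_left 2).tsum_add (hv.mul_left 2)]
  exact hs'.tsum_le_tsum hle hs

theorem abs_le_sqrt_of_hasSum_sq {α : ℕ → ℝ} {A : ℝ} (hα : HasSum (fun k => α k ^ 2) A) (k : ℕ) :
    |α k| ≤ √A :=
  Real.abs_le_sqrt (le_hasSum hα k fun _ _ => sq_nonneg _)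

theorem summable_chaosDelta {q : ℕ} (a : Fin q → ℝ) {α : ℕ → ℝ} {A : ℝ}
    (hα : HasSum (fun k => α k ^ 2) A) :
    Summable fun k => α k ^ 2 * ∏ r, (α k - a r) ^ 2 := by
  refine Summable.of_nonneg_of_le (fun k => by positivity) (fun k => ?_)
    (hα.summable.mul_right (∏ r, (√A + |a r|) ^ 2))
  refine mul_le_mul_of_nonneg_left (Finset.prod_le_prod (fun r _ => sq_nonneg _) fun r _ => ?_)
    (sq_nonneg _)
  rw [← sq_abs (α k - a r)]
  gcongr
  exact (abs_sub _ _).trans (by gcongr; exact abs_le_sqrt_of_hasSum_sq hα k)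

/-- A labelling `o` of the terms of `α` by the roots `0` (label `none`) and `a r` (label `some r`),
at distance at most `|α k|`: the power sums of the associated roots. -/
theorem hasSum_label_pow {q : ℕ} (a : Fin q → ℝ) {o : ℕ → Option (Fin q)}
    (hfin : ∀ r, {k | o k = some r}.Finite) {j : ℕ} (hj : j ≠ 0) :
    HasSum (fun k => ((o k).elim 0 a) ^ j) (∑ r, ({k | o k = some r}.ncard : ℝ) * a r ^ j) := by
  have h : ∀ r, HasSum (fun k => if o k = some r then a r ^ j else 0)
      (({k | o k = some r}.ncard : ℝ) * a r ^ j) := fun r => by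
    have := hasSum_sum_of_ne_finset_zero (f := fun k => if o k = some r then a r ^ j else 0)
      (s := (hfin r).toFinset) (L := .unconditional _) (fun k hk => by simpa using fun h => absurd h (by simpa using hk))
    convert this using 1
    rw [Finset.sum_congr rfl (g := fun _ => a r ^ j) (fun k hk => by simpa using fun h => absurd (by simpa using hk) h),
      Finset.sum_const, Set.ncard_eq_toFinset_card _ (hfin r), nsmul_eq_mul]
  convert hasSum_sum fun r (_ : r ∈ Finset.univ) => h r using 2 with k
  cases o k with
  | none => simp [hj]
  | some r => simp

/-- Each index labelled `r` contributes at least `a r ^ 2 / 4` to the total `A`. -/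
theorem finite_label_and_ncard_le {q : ℕ} {a : Fin q → ℝ} (ha0 : ∀ i, a i ≠ 0) {α : ℕ → ℝ} {A : ℝ}
    (hα : HasSum (fun k => α k ^ 2) A) {o : ℕ → Option (Fin q)}
    (ho : ∀ k, |(o k).elim 0 a| ≤ 2 * |α k|) (r : Fin q) :
    {k | o k = some r}.Finite ∧ ({k | o k = some r}.ncard : ℝ) ≤ 4 * A / a r ^ 2 := by
  have hpos : 0 < a r ^ 2 / 4 := by have := ha0 r; positivity
  have hle : ∀ k, o k = some r → a r ^ 2 / 4 ≤ α k ^ 2 := fun k hk => by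
    have := ho k
    rw [hk, Option.elim_some] at this
    have := pow_le_pow_left₀ (abs_nonneg _) this 2
    rw [mul_pow, sq_abs, sq_abs] at this
    linarith
  have hfin : {k | o k = some r}.Finite := by
    have h := hα.summable.tendsto_cofinite_zero.eventually (gt_mem_nhds hpos)
    rw [Filter.eventually_cofinite] at h
    exact h.subset fun k hk => by simpa using hle k hk
  refine ⟨hfin, ?_⟩
  have h1 : (hfin.toFinset.card : ℝ) * (a r ^ 2 / 4) ≤ A := by
    rw [← nsmul_eq_mul]
    exact (Finset.card_nsmul_le_sum _ _ _ fun k hk => hle k (by simpa using hk)).trans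
      (sum_le_hasSum _ (fun _ _ => sq_nonneg _) hα)
  rw [Set.ncard_eq_toFinset_card _ hfin]
  have := ha0 r
  rw [le_div_iff₀ (by positivity)]
  linarith

theorem exists_embedding_of_ncard_eq_one {q : ℕ} (a : Fin q → ℝ) {o : ℕ → Option (Fin q)}
    (h : ∀ r, {k | o k = some r}.ncard = 1) :
    ∃ k : Fin q ↪ ℕ, ∀ i, Function.extend k a 0 i = (o i).elim 0 a := by
  choose k hk using fun r => Set.ncard_eq_one.1 (h r)
  have hk' : ∀ r i, o i = some r ↔ i = k r := fun r i => by
    simpa using Set.ext_iff.1 (hk r) i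
  have hinj : Function.Injective k := fun r s hrs => by
    have h1 := (hk' r (k r)).2 rfl
    have h2 := (hk' s (k r)).2 hrs
    simpa using h1.symm.trans h2
  refine ⟨⟨k, hinj⟩, fun i => ?_⟩
  cases hi : o i with
  | none =>
    rw [Function.extend_apply']
    · simp
    · rintro ⟨r, hr⟩
      have := (hk' r i).2 hr.symm
      simp [hi] at this
  | some r =>
    obtain rfl := (hk' r i).1 hi
    exact hinj.extend_apply a 0 r

theorem abs_tsum_pow_sub_sum_le {q : ℕ} (a : Fin q → ℝ) {α : ℕ → ℝ} {A : ℝ}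
    (hα : HasSum (fun k => α k ^ 2) A) {o : ℕ → Option (Fin q)}
    (ho : ∀ k, |(o k).elim 0 a| ≤ 2 * |α k|) (hfin : ∀ r, {k | o k = some r}.Finite)
    (hs : Summable fun k => (α k - (o k).elim 0 a) ^ 2) {j : ℕ} (hj : 2 ≤ j) :
    |∑' i, α i ^ j - ∑ r, ({k | o k = some r}.ncard : ℝ) * a r ^ j| ≤
      j * 2 ^ (j - 1) * √A ^ (j - 2) * (√(∑' k, (α k - (o k).elim 0 a) ^ 2) * √A) := by
  obtain ⟨hcs, hcs'⟩ := summable_mul_and_tsum_mul_le_sqrt_mul_sqrt hs hα.summable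
  have hb := fun i => abs_pow_sub_pow_le_of_abs_le (abs_le_sqrt_of_hasSum_sq hα i) (ho i) hj
  have hρs := hasSum_label_pow a hfin (show j ≠ 0 by omega)
  have hsd : Summable fun i => |α i ^ j - (o i).elim 0 a ^ j| :=
    Summable.of_nonneg_of_le (fun _ => abs_nonneg _) hb (hcs.mul_left _)
  have hsα : Summable fun i => α i ^ j := by
    simpa using hsd.of_abs.add hρs.summable
  rw [← hρs.tsum_eq, ← hsα.tsum_sub hρs.summable]
  have h1 : |∑' i, (α i ^ j - (o i).elim 0 a ^ j)| ≤ ∑' i, |α i ^ j - (o i).elim 0 a ^ j| :=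
    norm_tsum_le_tsum_norm (f := fun i => α i ^ j - (o i).elim 0 a ^ j) hsd
  have h2 := hsd.tsum_le_tsum hb (hcs.mul_left (j * 2 ^ (j - 1) * √A ^ (j - 2)))
  rw [tsum_mul_left] at h2
  rw [hα.tsum_eq] at hcs'
  exact h1.trans (h2.trans (mul_le_mul_of_nonneg_left hcs' (by positivity)))

/-! ### Matching the coefficients with those of the target. -/

/-- The deterministic core. `J` is any set of exponents whose power sums separate nonzero integer
vectors from `0`; parts (a) and (b) differ only in its choice. -/
theorem exists_embedding_sqrt_le {q : ℕ} {a : Fin q → ℝ} (ha0 : ∀ i, a i ≠ 0)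
    (ha : Function.Injective a) (J : Finset ℕ) (hJ2 : ∀ j ∈ J, 2 ≤ j)
    (hJ : ∀ m : Fin q → ℤ, (∀ j ∈ J, ∑ r, (m r : ℝ) * a r ^ j = 0) → m = 0) :
    ∃ C > 0, ∀ α : ℕ → ℝ, HasSum (fun k => α k ^ 2) (∑ r, a r ^ 2) →
      ∃ k : Fin q ↪ ℕ, √(∑' i, (α i - Function.extend k a 0 i) ^ 2) ≤
        C * (√(chaosDelta a α) + ∑ j ∈ J, |∑' i, α i ^ j - ∑ r, a r ^ j|) := by
  set A := ∑ r, a r ^ 2 with hA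
  have hA0 : 0 ≤ A := by positivity
  -- The label `none` stands for the root `0`, which accounts for the factor `α k ^ 2` in the
  -- discrepancy.
  have hb : Function.Injective fun o : Option (Fin q) => o.elim 0 a := by
    rintro (_ | r) (_ | s) h
    · rfl
    · exact absurd h.symm (ha0 s)
    · exact absurd h (ha0 r)
    · exact congrArg some (ha h)
  obtain ⟨c, hc, hroot⟩ := exists_nearest_root hb
  -- This box contains all possible vectors of label counts minus one, and it depends on `a` only,
  -- hence so does `c'`.
  have hTfin : {m : Fin q → ℤ | (∀ r, -1 ≤ m r ∧ m r ≤ ⌈4 * A / a r ^ 2⌉) ∧ m ≠ 0}.Finite := by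
    refine (Set.Finite.pi' fun r => Set.finite_Icc (-1) ⌈4 * A / a r ^ 2⌉).subset ?_
    exact fun m hm r => hm.1 r
  obtain ⟨c', hc', hT⟩ := exists_pos_forall_le hTfin
    (f := fun m => ∑ j ∈ J, |∑ r, (m r : ℝ) * a r ^ j|) (fun m hm => by
      refine lt_of_le_of_ne (by positivity) fun h0 => hm.2 (hJ m fun j hj => ?_)
      have := (Finset.sum_eq_zero_iff_of_nonneg fun j _ => abs_nonneg _).1 h0.symm j hj
      exact abs_eq_zero.1 this)
  set L : ℝ := ∑ j ∈ J, j * 2 ^ (j - 1) * √A ^ (j - 2) with hL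
  have hL0 : 0 ≤ L := by positivity
  set K : ℝ := 1 + L * √A / √c with hK
  have hK0 : 0 ≤ K := by positivity
  -- The first summand serves the case `m = 0`, the second the case `m ≠ 0`.
  refine ⟨1 / √c + 2 * √A * K / c', by positivity, fun α hα => ?_⟩
  choose o ho_min ho using fun k => hroot (α k)
  have hsum := summable_chaosDelta a hα
  set D := chaosDelta a α with hD
  have hD0 : 0 ≤ D := tsum_nonneg fun k => by positivity
  set ρ : ℕ → ℝ := fun k => (o k).elim 0 a with hρ
  have hdist : ∀ k, |α k - ρ k| ≤ |α k| := fun k => by simpa using ho_min k none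
  have hρ2 : ∀ k, |ρ k| ≤ 2 * |α k| := fun k => by
    have := abs_sub_abs_le_abs_sub (ρ k) (α k)
    rw [abs_sub_comm] at this
    linarith [hdist k]
  have hle : ∀ k, (α k - ρ k) ^ 2 ≤ c⁻¹ * (α k ^ 2 * ∏ r, (α k - a r) ^ 2) := fun k => by
    have := ho k
    rw [Fintype.prod_option] at this
    simp only [Option.elim_none, Option.elim_some, sub_zero] at this
    rw [inv_mul_eq_div, le_div_iff₀' hc]
    exact this
  have hs2 : Summable fun k => (α k - ρ k) ^ 2 :=
    Summable.of_nonneg_of_le (fun _ => sq_nonneg _) hle (hsum.mul_left _)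
  have hs2le : √(∑' k, (α k - ρ k) ^ 2) ≤ √D / √c := by
    rw [← Real.sqrt_div hD0]
    refine Real.sqrt_le_sqrt ((hs2.tsum_le_tsum hle (hsum.mul_left _)).trans ?_)
    rw [tsum_mul_left, inv_mul_eq_div]
    rfl
  have hlab := finite_label_and_ncard_le ha0 hα hρ2
  set m : Fin q → ℤ := fun r => ({k | o k = some r}.ncard : ℤ) - 1 with hm
  set e : ℝ := √D + ∑ j ∈ J, |∑' i, α i ^ j - ∑ r, a r ^ j| with he
  have he1 : √D ≤ e := le_add_of_nonneg_right (by positivity)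
  have he0 : 0 ≤ e := (Real.sqrt_nonneg _).trans he1
  by_cases hm0 : m = 0
  · have hone : ∀ r, {k | o k = some r}.ncard = 1 := fun r => by
      have := congrFun hm0 r
      simp only [hm, Pi.zero_apply] at this
      omega
    obtain ⟨k, hk⟩ := exists_embedding_of_ncard_eq_one a hone
    refine ⟨k, ?_⟩
    simp_rw [hk]
    calc √(∑' i, (α i - ρ i) ^ 2) ≤ √D / √c := hs2le
      _ ≤ e / √c := by gcongr
      _ = 1 / √c * e := by ring
      _ ≤ _ := by
        gcongr
        exact le_add_of_nonneg_right (by positivity)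
  -- Any embedding will do: the distance is at most `2 * √A` and `c' ≤ K * e`.
  · let k : Fin q ↪ ℕ := Fin.valEmbedding
    refine ⟨k, ?_⟩
    have hk := hasSum_extend_pow k a two_ne_zero
    have h4 : √(∑' i, (α i - Function.extend k a 0 i) ^ 2) ≤ 2 * √A := by
      have := (summable_sq_sub hα.summable hk.summable).2
      rw [hα.tsum_eq, hk.tsum_eq] at this
      rw [Real.sqrt_le_left (by positivity), mul_pow, Real.sq_sqrt hA0]
      linarith
    have hmT := hT m ⟨fun r => ⟨by simp only [hm]; omega, by
      have h1 : (({k | o k = some r}.ncard : ℤ) : ℝ) ≤ ⌈4 * A / a r ^ 2⌉ :=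
        le_trans (by exact_mod_cast (hlab r).2) (Int.le_ceil _)
      have h2 : ({k | o k = some r}.ncard : ℤ) ≤ ⌈4 * A / a r ^ 2⌉ := by exact_mod_cast h1
      simp only [hm]
      omega⟩, hm0⟩
    have hterm : ∀ j ∈ J, |∑ r, (m r : ℝ) * a r ^ j| ≤ |∑' i, α i ^ j - ∑ r, a r ^ j| +
        j * 2 ^ (j - 1) * √A ^ (j - 2) * (√D / √c * √A) := fun j hj => by
      have h1 : ∑ r, (m r : ℝ) * a r ^ j = (∑' i, α i ^ j - ∑ r, a r ^ j) -
          (∑' i, α i ^ j - ∑ r, ({k | o k = some r}.ncard : ℝ) * a r ^ j) := by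
        rw [sub_sub_sub_cancel_left, ← Finset.sum_sub_distrib]
        refine Finset.sum_congr rfl fun r _ => ?_
        simp only [hm]
        push_cast
        ring
      rw [h1]
      refine (abs_sub _ _).trans (add_le_add le_rfl ?_)
      refine (abs_tsum_pow_sub_sum_le a hα hρ2 (fun r => (hlab r).1) hs2 (hJ2 j hj)).trans ?_
      exact mul_le_mul_of_nonneg_left (mul_le_mul_of_nonneg_right hs2le (Real.sqrt_nonneg _))
        (by positivity)
    have hKe : c' ≤ K * e := by
      refine hmT.trans ((Finset.sum_le_sum hterm).trans ?_)
      rw [Finset.sum_add_distrib, ← Finset.sum_mul]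
      have : L * (√D / √c * √A) ≤ L * √A / √c * e := by
        calc L * (√D / √c * √A) = L * √A / √c * √D := by ring
          _ ≤ _ := by gcongr
      have h3 : ∑ j ∈ J, |∑' i, α i ^ j - ∑ r, a r ^ j| ≤ e :=
        le_add_of_nonneg_left (Real.sqrt_nonneg _)
      calc _ ≤ e + L * √A / √c * e := add_le_add h3 this
        _ = K * e := by rw [hK]; ring
    calc _ ≤ 2 * √A := h4
      _ ≤ 2 * √A * (K * e / c') := le_mul_of_one_le_right (by positivity) ((one_le_div hc').2 hKe)
      _ = 2 * √A * K / c' * e := by ring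
      _ ≤ _ := by
        gcongr
        exact le_add_of_nonneg_left (by positivity)

/-- A Vandermonde system in the unknowns `m r * a r ^ 2`. -/
theorem eq_zero_of_forall_sum_mul_pow_eq_zero {q : ℕ} {a : Fin q → ℝ} (ha0 : ∀ i, a i ≠ 0)
    (ha : Function.Injective a) (m : Fin q → ℤ)
    (h : ∀ j ∈ Finset.Icc 2 (q + 1), ∑ r, (m r : ℝ) * a r ^ j = 0) : m = 0 := by
  have h0 : (fun r => (m r : ℝ) * a r ^ 2) = 0 := by
    refine Matrix.eq_zero_of_forall_pow_sum_mul_pow_eq_zero ha fun i => ?_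
    rw [← h (i + 2) (by simp)]
    refine Finset.sum_congr rfl fun r _ => by ring
  funext r
  have := congrFun h0 r
  simpa [ha0 r] using this

theorem eq_zero_of_sum_mul_sq_eq_zero {q : ℕ} {a : Fin q → ℝ}
    (ha : Module.finrank ℚ (Submodule.span ℚ (Set.range fun i => a i ^ 2)) = q) (m : Fin q → ℤ)
    (h : ∑ r, (m r : ℝ) * a r ^ 2 = 0) : m = 0 := by
  have hli : LinearIndependent ℚ fun i => a i ^ 2 := by
    rw [linearIndependent_iff_card_eq_finrank_span, Fintype.card_fin]
    exact ha.symm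
  rw [Fintype.linearIndependent_iff] at hli
  funext r
  have := hli (fun r => (m r : ℚ)) (by simpa [Rat.smul_def] using h) r
  simpa using this

theorem chaosDelta_self {q : ℕ} (a : Fin q → ℝ) : chaosDelta a a = 0 := by
  have h : ∀ k, a k ^ 2 * ∏ r, (a k - a r) ^ 2 = 0 := fun k => by
    rw [Finset.prod_eq_zero (Finset.mem_univ k) (by simp), mul_zero]
  simp [chaosDelta, h]

/-! ### Moments and generating functions of squared Gaussians and their finite sums. -/

theorem integral_pow_four_gaussianReal : ∫ x, x ^ 4 ∂gaussianReal 0 1 = 3 := by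
  have h : iteratedDeriv 4 (mgf (fun x => x) (gaussianReal 0 1)) 0 = ∫ x, x ^ 4 ∂gaussianReal 0 1 := by
    rw [iteratedDeriv_mgf_zero] <;> simp
  rw [← h, mgf_fun_id_gaussianReal]
  -- Differentiating `p(t) exp (t² / 2)` replaces `p` by `p' + X p`; four iterations from `p = 1`
  -- give the moment.
  have key : ∀ p : Polynomial ℝ, deriv (fun t => p.eval t * Real.exp (t ^ 2 / 2)) =
      fun t => (p.derivative + .X * p).eval t * Real.exp (t ^ 2 / 2) := fun p => by
    funext t
    have h2 : HasDerivAt (fun t : ℝ => t ^ 2 / 2) t t := by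
      simpa using (hasDerivAt_pow 2 t).div_const 2
    rw [((p.hasDerivAt t).fun_mul h2.exp).deriv]
    simp only [Polynomial.eval_add, Polynomial.eval_mul, Polynomial.eval_X]
    ring
  have h0 : (fun t : ℝ => Real.exp (0 * t + ((1 : NNReal) : ℝ) * t ^ 2 / 2)) =
      fun t => (1 : Polynomial ℝ).eval t * Real.exp (t ^ 2 / 2) := by
    funext t
    simp
  rw [iteratedDeriv_eq_iterate, h0]
  simp only [Function.iterate_succ, Function.iterate_zero, Function.comp_apply, id, key]
  simp
  norm_num

theorem integral_exp_mul_sq_gaussianReal {s : ℝ} (hs : s < 1 / 2) :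
    ∫ x, Real.exp (s * x ^ 2) ∂gaussianReal 0 1 = (√(1 - 2 * s))⁻¹ := by
  rw [integral_gaussianReal_eq_integral_smul one_ne_zero]
  have h : ∀ x : ℝ, gaussianPDFReal 0 1 x • Real.exp (s * x ^ 2) =
      (√(2 * Real.pi))⁻¹ * Real.exp (-(1 / 2 - s) * x ^ 2) := fun x => by
    rw [gaussianPDFReal, smul_eq_mul, mul_assoc, ← Real.exp_add]
    simp only [NNReal.coe_one, mul_one, sub_zero]
    congr 2
    ring
  simp_rw [h]
  rw [integral_const_mul, integral_gaussian, ← Real.sqrt_inv, ← Real.sqrt_inv, ← Real.sqrt_mul (by positivity)]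
  congr 1
  have : 1 / 2 - s ≠ 0 := by linarith
  have : 1 - 2 * s ≠ 0 := by linarith
  field_simp

/-- The cumulant generating function of `X ^ 2 - 1` for a standard Gaussian `X`, on `s < 1 / 2`. -/
noncomputable def chiSqCgf (s : ℝ) : ℝ := -s - Real.log (1 - 2 * s) / 2

section Gaussian

variable {Ω : Type*} [MeasurableSpace Ω] {P : Measure Ω} {X : Ω → ℝ}

theorem mgf_mul_sq_sub_one (hX : HasLaw X (gaussianReal 0 1) P) {b t : ℝ} (h : t * b < 1 / 2) :
    mgf (fun ω => b * (X ω ^ 2 - 1)) P t = Real.exp (chiSqCgf (t * b)) := by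
  have h1 : ∀ ω, Real.exp (t * (b * (X ω ^ 2 - 1))) =
      Real.exp (-(t * b)) * Real.exp (t * b * X ω ^ 2) := fun ω => by
    rw [← Real.exp_add]
    ring_nf
  rw [mgf]
  simp_rw [h1]
  rw [integral_const_mul]
  have h2 := hX.integral_comp (f := fun x => Real.exp (t * b * x ^ 2)) (by fun_prop)
  simp only [Function.comp_def] at h2
  have h3 : 0 < 1 - 2 * (t * b) := by linarith
  rw [h2, integral_exp_mul_sq_gaussianReal h, chiSqCgf, sub_eq_add_neg (-(t * b)), Real.exp_add,
    Real.exp_neg (_ / 2), ← Real.log_sqrt h3.le, Real.exp_log (Real.sqrt_pos.2 h3)]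

theorem memLp_sq_sub_one (hX : HasLaw X (gaussianReal 0 1) P) :
    MemLp (fun ω => X ω ^ 2 - 1) 2 P := by
  have := hX.isProbabilityMeasure
  have h : MemLp (fun x : ℝ => x ^ 2 - 1) 2 (gaussianReal 0 1) := by
    refine MemLp.sub ?_ (memLp_const 1)
    have h4 := (memLp_id_gaussianReal' (μ := 0) (v := 1) 4 (by simp)).norm_rpow_div 2
    have e : (4 : ℝ≥0∞) / 2 = 2 := by
      rw [show (4 : ℝ≥0∞) = 2 * 2 by norm_num]
      exact ENNReal.mul_div_cancel_right (by simp) (by simp)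
    rw [e] at h4
    simpa using h4
  rw [← hX.map_eq] at h
  exact h.comp_of_map hX.aemeasurable

theorem integral_sq_sub_one (hX : HasLaw X (gaussianReal 0 1) P) : ∫ ω, (X ω ^ 2 - 1) ∂P = 0 := by
  have h := hX.integral_comp (f := fun x => x ^ 2 - 1) (by fun_prop)
  simp only [Function.comp_def] at h
  rw [h, integral_sub _ (integrable_const 1)]
  · have := variance_fun_id_gaussianReal (μ := 0) (v := 1)
    rw [variance_of_integral_eq_zero (by fun_prop) (by simp)] at this
    simp [this]
  · simpa using (memLp_id_gaussianReal (μ := 0) (v := 1) 2).integrable_sq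

theorem variance_sq_sub_one (hX : HasLaw X (gaussianReal 0 1) P) :
    Var[fun ω => X ω ^ 2 - 1; P] = 2 := by
  have hX' := hX.isProbabilityMeasure
  have hm := memLp_sq_sub_one hX
  rw [variance_of_integral_eq_zero hm.aestronglyMeasurable.aemeasurable (integral_sq_sub_one hX)]
  have hi : Integrable (fun ω => X ω ^ 2 - 1) P := hm.integrable one_le_two
  have h4 : ∫ ω, X ω ^ 4 ∂P = 3 := by
    have := hX.integral_comp (f := fun x => x ^ 4) (by fun_prop)
    rw [← integral_pow_four_gaussianReal, ← this]
    rfl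
  have i4 : Integrable (fun ω => X ω ^ 4) P := .of_integral_ne_zero (by rw [h4]; norm_num)
  have : ∀ ω, (X ω ^ 2 - 1) ^ 2 = X ω ^ 4 - 2 * (X ω ^ 2 - 1) - 1 := fun ω => by ring
  simp_rw [this]
  have i5 : Integrable (fun ω => X ω ^ 4 - 2 * (X ω ^ 2 - 1)) P := i4.sub (hi.const_mul 2)
  rw [integral_sub i5 (integrable_const 1), integral_sub i4 (hi.const_mul 2),
    integral_const_mul, integral_sq_sub_one hX, h4]
  simp
  norm_num

end Gaussian

section Family

variable {Ω ι : Type*} [MeasurableSpace Ω] {P : Measure Ω} {N : ι → Ω → ℝ}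

theorem IsStdGaussianFamily.iIndepFun_mul_sq_sub_one (hN : IsStdGaussianFamily N P) (b : ι → ℝ) :
    iIndepFun (fun k ω => b k * (N k ω ^ 2 - 1)) P :=
  hN.indep.comp (fun k x => b k * (x ^ 2 - 1)) fun k => by fun_prop

theorem IsStdGaussianFamily.memLp_sum (hN : IsStdGaussianFamily N P) (b : ι → ℝ) (s : Finset ι) :
    MemLp (fun ω => ∑ k ∈ s, b k * (N k ω ^ 2 - 1)) 2 P :=
  memLp_finsetSum _ fun k _ => (memLp_sq_sub_one (hN.hasLaw k)).const_mul (b k)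

theorem IsStdGaussianFamily.integral_sum_sq (hN : IsStdGaussianFamily N P) (b : ι → ℝ)
    (s : Finset ι) :
    ∫ ω, (∑ k ∈ s, b k * (N k ω ^ 2 - 1)) ^ 2 ∂P = 2 * ∑ k ∈ s, b k ^ 2 := by
  have := hN.indep.isProbabilityMeasure
  have hm := fun k => (memLp_sq_sub_one (hN.hasLaw k)).const_mul (b k)
  have h0 : ∫ ω, ∑ k ∈ s, b k * (N k ω ^ 2 - 1) ∂P = 0 := by
    rw [integral_finsetSum _ fun k _ => (hm k).integrable one_le_two]
    refine Finset.sum_eq_zero fun k _ => ?_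
    rw [integral_const_mul, integral_sq_sub_one (hN.hasLaw k), mul_zero]
  rw [← variance_of_integral_eq_zero (hN.memLp_sum b s).aestronglyMeasurable.aemeasurable h0]
  have h := IndepFun.variance_sum (s := s) (fun k _ => hm k) fun i _ j _ hij =>
    (hN.iIndepFun_mul_sq_sub_one b).indepFun hij
  rw [show (∑ k ∈ s, fun ω => b k * (N k ω ^ 2 - 1)) = fun ω => ∑ k ∈ s, b k * (N k ω ^ 2 - 1) by
    ext; simp] at h
  rw [h, Finset.mul_sum]
  refine Finset.sum_congr rfl fun k _ => ?_
  rw [variance_const_mul, variance_sq_sub_one (hN.hasLaw k), mul_comm]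

theorem IsStdGaussianFamily.mgf_sum (hN : IsStdGaussianFamily N P) {b : ι → ℝ} {s : Finset ι} {t : ℝ}
    (ht : ∀ k ∈ s, t * b k < 1 / 2) :
    mgf (fun ω => ∑ k ∈ s, b k * (N k ω ^ 2 - 1)) P t =
      Real.exp (∑ k ∈ s, chiSqCgf (t * b k)) := by
  have h := (hN.iIndepFun_mul_sq_sub_one b).mgf_sum₀ (t := t)
    (fun k => ((memLp_sq_sub_one (hN.hasLaw k)).const_mul (b k)).aestronglyMeasurable.aemeasurable) s
  rw [show (∑ k ∈ s, fun ω => b k * (N k ω ^ 2 - 1)) = fun ω => ∑ k ∈ s, b k * (N k ω ^ 2 - 1) by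
    ext; simp] at h
  rw [h, Real.exp_sum]
  exact Finset.prod_congr rfl fun k hk => mgf_mul_sq_sub_one (hN.hasLaw k) (ht k hk)

end Family

/-- The law depends on `a` alone, so the target can be realized on the space of the approximating
variables. -/
theorem IsStdGaussianFamily.map_sum {ι Ω : Type*} [Fintype ι] [MeasurableSpace Ω]
    {P : Measure Ω} {N : ι → Ω → ℝ} (hN : IsStdGaussianFamily N P) (a : ι → ℝ) :
    P.map (fun ω => ∑ i, a i * (N i ω ^ 2 - 1)) =
      (Measure.pi fun _ => gaussianReal 0 1).map fun x : ι → ℝ => ∑ i, a i * (x i ^ 2 - 1) := by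
  have := hN.indep.isProbabilityMeasure
  have hm := fun i => (hN.hasLaw i).aemeasurable
  have h := hN.indep.map_fun_eq_pi_map hm
  simp_rw [fun i => (hN.hasLaw i).map_eq] at h
  have hg : Measurable fun x : ι → ℝ => ∑ i, a i * (x i ^ 2 - 1) := by fun_prop
  rw [← h, AEMeasurable.map_map_of_aemeasurable hg.aemeasurable (by fun_prop)]
  rfl

theorem integral_sq_eq_norm_toLp_sq {Ω : Type*} [MeasurableSpace Ω] {P : Measure Ω} {f : Ω → ℝ}
    (hf : MemLp f 2 P) : ∫ ω, f ω ^ 2 ∂P = ‖hf.toLp f‖ ^ 2 := by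
  rw [Lp.norm_toLp, hf.eLpNorm_eq_integral_rpow_norm (by simp) (by simp),
    ENNReal.toReal_ofReal (by positivity)]
  simp only [ENNReal.toReal_ofNat, Real.rpow_ofNat, Real.norm_eq_abs, sq_abs]
  rw [← Real.rpow_natCast, ← Real.rpow_mul (by positivity)]
  simp

theorem eLpNorm_two_eq_ofReal_sqrt {Ω : Type*} [MeasurableSpace Ω] {P : Measure Ω} {f : Ω → ℝ}
    (hf : MemLp f 2 P) : eLpNorm f 2 P = ENNReal.ofReal √(∫ ω, f ω ^ 2 ∂P) := by
  rw [integral_sq_eq_norm_toLp_sq hf, Real.sqrt_sq (norm_nonneg _), Lp.norm_toLp,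
    ENNReal.ofReal_toReal hf.2.ne]

/-! ### Chaos series in `L²` and their couplings. -/

section Series

variable {Ω : Type*} [MeasurableSpace Ω] {P : Measure Ω} {N : ℕ → Ω → ℝ}

theorem IsSecondChaosSeries.hasSum_sq {F : Ω → ℝ} {α : ℕ → ℝ} (hF : IsSecondChaosSeries F α N P)
    (hN : IsStdGaussianFamily N P) : HasSum (fun k => α k ^ 2) ((∫ ω, F ω ^ 2 ∂P) / 2) := by
  have hS := fun m : ℕ => hN.memLp_sum α (Finset.range m)
  have h1 : Tendsto (fun m => (hS m).toLp _) atTop (𝓝 (hF.memLp.toLp F)) := by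
    rw [Lp.tendsto_Lp_iff_tendsto_eLpNorm'' _ hS]
    refine hF.tendsto.congr fun m => ?_
    rw [← eLpNorm_neg]
    congr 1
    ext ω
    simp
  have h2 := (h1.norm.pow 2).div_const 2
  simp_rw [← integral_sq_eq_norm_toLp_sq, hN.integral_sum_sq,
    mul_div_cancel_left₀ _ (two_ne_zero (α := ℝ))] at h2
  rwa [hasSum_iff_tendsto_nat_of_nonneg fun _ => sq_nonneg _]

theorem IsSecondChaosSeries.sub {F G : Ω → ℝ} {α β : ℕ → ℝ} (hN : IsStdGaussianFamily N P)
    (hF : IsSecondChaosSeries F α N P) (hG : IsSecondChaosSeries G β N P) :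
    IsSecondChaosSeries (fun ω => F ω - G ω) (fun k => α k - β k) N P where
  memLp := hF.memLp.sub hG.memLp
  tendsto := by
    have h := hF.tendsto.add hG.tendsto
    rw [add_zero] at h
    refine tendsto_of_tendsto_of_tendsto_of_le_of_le tendsto_const_nhds h (fun _ => zero_le) fun m => ?_
    refine le_trans (le_of_eq ?_) (eLpNorm_sub_le
      (hF.memLp.sub (hN.memLp_sum α (Finset.range m))).aestronglyMeasurable
      (hG.memLp.sub (hN.memLp_sum β (Finset.range m))).aestronglyMeasurable one_le_two)
    congr 1
    ext ω
    simp only [sub_mul, Finset.sum_sub_distrib, Pi.sub_apply]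
    ring

/-- A finite sum, its indices being embedded in `ℕ`, as a series. -/
theorem IsStdGaussianFamily.isSecondChaosSeries_sum {q : ℕ} (hN : IsStdGaussianFamily N P)
    (a : Fin q → ℝ) (k : Fin q ↪ ℕ) :
    IsSecondChaosSeries (fun ω => ∑ r, a r * (N (k r) ω ^ 2 - 1)) (Function.extend k a 0) N P where
  memLp := memLp_finsetSum _ fun r _ => (memLp_sq_sub_one (hN.hasLaw (k r))).const_mul (a r)
  tendsto := by
    refine tendsto_const_nhds.congr' ?_
    filter_upwards [eventually_ge_atTop ((Finset.univ.map k).sup id + 1)] with m hm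
    have hz : ∀ ω, ∑ r, a r * (N (k r) ω ^ 2 - 1) -
        ∑ i ∈ Finset.range m, Function.extend k a 0 i * (N i ω ^ 2 - 1) = 0 := fun ω => by
      have hsub : Finset.univ.map k ⊆ Finset.range m := fun i hi => by
        have : i ≤ (Finset.univ.map k).sup id := Finset.le_sup (f := id) hi
        exact Finset.mem_range.2 (by omega)
      rw [← Finset.sum_subset hsub, Finset.sum_map]
      · simp [k.injective.extend_apply]
      · intro i _ hi
        rw [Function.extend_apply' _ _ _ fun ⟨r, hr⟩ => hi (by simp [← hr])]
        simp
    simp_rw [hz]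
    simp

theorem IsStdGaussianFamily.comp_embedding {ι κ : Type*} {N : κ → Ω → ℝ}
    (hN : IsStdGaussianFamily N P) (k : ι ↪ κ) : IsStdGaussianFamily (fun r => N (k r)) P where
  hasLaw r := hN.hasLaw (k r)
  indep := hN.indep.precomp k.injective

/-- A coupling realized by two random variables on the same space bounds the distance. -/
theorem wassersteinDist_two_map_le {F G : Ω → ℝ} (hF : MemLp F 2 P) (hG : MemLp G 2 P) :
    wassersteinDist 2 (P.map F) (P.map G) ≤ ENNReal.ofReal √(∫ ω, (F ω - G ω) ^ 2 ∂P) := by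
  have hFm := hF.aestronglyMeasurable.aemeasurable
  have hGm := hG.aestronglyMeasurable.aemeasurable
  have hpair : AEMeasurable (fun ω => (F ω, G ω)) P := hFm.prodMk hGm
  rw [← eLpNorm_two_eq_ofReal_sqrt (f := fun ω => F ω - G ω) (hF.sub hG),
    eLpNorm_eq_lintegral_rpow_enorm_toReal (by simp) (by simp), wassersteinDist]
  simp only [ENNReal.toReal_ofNat]
  gcongr
  have hfst : (P.map fun ω => (F ω, G ω)).map Prod.fst = P.map F :=
    AEMeasurable.map_map_of_aemeasurable measurable_fst.aemeasurable hpair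
  have hsnd : (P.map fun ω => (F ω, G ω)).map Prod.snd = P.map G :=
    AEMeasurable.map_map_of_aemeasurable measurable_snd.aemeasurable hpair
  refine (iInf₂_le (P.map fun ω => (F ω, G ω)) ⟨hfst, hsnd⟩).trans (le_of_eq ?_)
  rw [lintegral_map' (by fun_prop) hpair]
  simp [edist_eq_enorm_sub]

theorem IsSecondChaosSeries.integral_sub_sq {q : ℕ} {F : Ω → ℝ} {α : ℕ → ℝ}
    (hF : IsSecondChaosSeries F α N P) (hN : IsStdGaussianFamily N P) (a : Fin q → ℝ)
    (k : Fin q ↪ ℕ) :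
    ∫ ω, (F ω - ∑ r, a r * (N (k r) ω ^ 2 - 1)) ^ 2 ∂P =
      2 * ∑' i, (α i - Function.extend k a 0 i) ^ 2 := by
  rw [((hF.sub hN (hN.isSecondChaosSeries_sum a k)).hasSum_sq hN).tsum_eq]
  ring

end Series

/-! ### Exponential moments and cumulants of chaos series. -/

theorem abs_exp_sub_exp_le (x y : ℝ) :
    |Real.exp x - Real.exp y| ≤ |x - y| * (Real.exp x + Real.exp y) := by
  have key : ∀ x y : ℝ, y ≤ x → |Real.exp x - Real.exp y| ≤ |x - y| * (Real.exp x + Real.exp y) :=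
    fun x y h => by
      rw [abs_of_nonneg (sub_nonneg.2 (Real.exp_le_exp.2 h)), abs_of_nonneg (sub_nonneg.2 h)]
      have h1 := Real.add_one_le_exp (y - x)
      have h2 : Real.exp y = Real.exp x * Real.exp (y - x) := by rw [← Real.exp_add]; ring_nf
      have h3 : 0 ≤ (x - y) * Real.exp y := mul_nonneg (sub_nonneg.2 h) (Real.exp_nonneg _)
      nlinarith [Real.exp_pos x]
  rcases le_total y x with h | h
  · exact key x y h
  · rw [abs_sub_comm, abs_sub_comm x, add_comm]
    exact key y x h

/-- The general term of the power series of `chiSqCgf`. -/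
noncomputable def chiSqCoeff (r : ℕ) : ℝ := if r < 2 then 0 else 2 ^ (r - 1) / r

theorem hasSum_chiSqCoeff {s : ℝ} (hs : |s| < 1 / 2) :
    HasSum (fun r => chiSqCoeff r * s ^ r) (chiSqCgf s) := by
  have h := (Real.hasSum_pow_div_log_of_abs_lt_one (x := 2 * s) (by
    rw [abs_mul, abs_two]; linarith)).div_const 2
  have h' := (hasSum_nat_add_iff' 1).2 h
  rw [← hasSum_nat_add_iff' 2]
  convert h' using 1
  · funext n
    simp only [chiSqCoeff, show ¬(n + 2 < 2) by omega, if_false, mul_pow]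
    push_cast
    have h2 : (n : ℝ) + 1 + 1 = n + 2 := by ring
    rw [h2, pow_succ 2 (n + 1)]
    have : (n : ℝ) + 2 ≠ 0 := by positivity
    field_simp
  · simp [Finset.sum_range_succ, chiSqCoeff, chiSqCgf]
    ring

/-- The factor `s ^ 2` gives summability over the coefficients and `(1 / 2) ^ r` over the degree, so
the double series can be rearranged. -/
theorem abs_chiSqCoeff_mul_pow_le {s : ℝ} (hs : |s| ≤ 1 / 4) (r : ℕ) :
    |chiSqCoeff r * s ^ r| ≤ 8 * s ^ 2 * (1 / 2) ^ r := by
  unfold chiSqCoeff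
  split_ifs with h
  · simp only [zero_mul, abs_zero]
    positivity
  · obtain ⟨n, rfl⟩ := Nat.exists_eq_add_of_le' (not_lt.1 h)
    rw [abs_mul, abs_div, abs_pow, abs_pow, abs_two, Nat.abs_cast]
    have h1 : (2 : ℝ) ^ (n + 2 - 1) / ((n + 2 : ℕ) : ℝ) ≤ 2 ^ n := by
      rw [show n + 2 - 1 = n + 1 by omega, pow_succ, div_le_iff₀ (by positivity)]
      push_cast
      have : (0 : ℝ) ≤ n := by positivity
      nlinarith [pow_pos (two_pos (α := ℝ)) n]
    calc _ ≤ 2 ^ n * |s| ^ (n + 2) := by gcongr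
      _ = (2 * |s|) ^ n * s ^ 2 := by rw [pow_add, sq_abs, mul_pow]; ring
      _ ≤ (1 / 2) ^ n * s ^ 2 := by
        gcongr
        linarith
      _ ≤ _ := by
        rw [pow_add]
        nlinarith [mul_nonneg (pow_pos (one_half_pos (α := ℝ)) n).le (sq_nonneg s)]

/-- The sum over `k` of the cumulant generating functions, and its expansion in power sums. -/
theorem hasSum_chiSqCgf {α : ℕ → ℝ} {A t : ℝ} (hα : HasSum (fun k => α k ^ 2) A)
    (ht : |t| * √A ≤ 1 / 4) :
    (Summable fun k => chiSqCgf (t * α k)) ∧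
      HasSum (fun r => t ^ r * (chiSqCoeff r * ∑' k, α k ^ r)) (∑' k, chiSqCgf (t * α k)) := by
  have hs : ∀ k, |t * α k| ≤ 1 / 4 := fun k => by
    rw [abs_mul]
    exact (mul_le_mul_of_nonneg_left (abs_le_sqrt_of_hasSum_sq hα k) (abs_nonneg t)).trans ht
  have hsum : Summable fun p : ℕ × ℕ => chiSqCoeff p.2 * (t * α p.1) ^ p.2 := by
    have hb : Summable fun k => 8 * (t * α k) ^ 2 := by
      simp_rw [mul_pow]
      exact (hα.summable.mul_left _).mul_left _
    have hprod := Summable.mul_of_nonneg (f := fun k => 8 * (t * α k) ^ 2)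
      (g := fun r : ℕ => (1 / 2 : ℝ) ^ r) hb summable_geometric_two
      (fun k => mul_nonneg (by norm_num) (sq_nonneg _)) (fun r => pow_nonneg (by norm_num) r)
    exact Summable.of_norm_bounded hprod fun p => abs_chiSqCoeff_mul_pow_le (hs p.1) p.2
  have h1 : HasSum (fun k => chiSqCgf (t * α k)) _ :=
    hsum.hasSum.prod_fiberwise fun k => hasSum_chiSqCoeff ((hs k).trans_lt (by norm_num))
  refine ⟨h1.summable, ?_⟩
  rw [h1.tsum_eq]
  have hswap : Summable fun p : ℕ × ℕ => chiSqCoeff p.1 * (t * α p.2) ^ p.1 :=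
    (Equiv.prodComm ℕ ℕ).summable_iff.2 hsum
  have h2 : ∑' p : ℕ × ℕ, chiSqCoeff p.2 * (t * α p.1) ^ p.2 =
      ∑' p : ℕ × ℕ, chiSqCoeff p.1 * (t * α p.2) ^ p.1 :=
    ((Equiv.prodComm ℕ ℕ).tsum_eq _).symm
  rw [h2]
  convert hswap.hasSum.prod_fiberwise fun r => (hswap.prod_factor r).hasSum using 2 with r
  -- For `r < 2` the power sum may diverge, but its coefficient is zero.
  simp_rw [mul_pow]
  rw [tsum_mul_left, tsum_mul_left]
  ring

section Mgf

variable {Ω : Type*} [MeasurableSpace Ω] {P : Measure Ω} {N : ℕ → Ω → ℝ} {F : Ω → ℝ} {α : ℕ → ℝ}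

theorem memLp_exp_of_mgf {X : Ω → ℝ} {t c : ℝ} (hX : AEStronglyMeasurable X P)
    (h : mgf X P (2 * t) = c) (hc : 0 < c) :
    MemLp (fun ω => Real.exp (t * X ω)) 2 P ∧
      eLpNorm (fun ω => Real.exp (t * X ω)) 2 P = ENNReal.ofReal √c := by
  have hsq : ∀ ω, Real.exp (t * X ω) ^ 2 = Real.exp (2 * t * X ω) := fun ω => by
    rw [← Real.exp_nat_mul]
    push_cast
    ring_nf
  -- A non-integrable function has integral `0` by convention, so a nonzero integral yields
  -- integrability.
  have hi : Integrable (fun ω => Real.exp (2 * t * X ω)) P :=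
    .of_integral_ne_zero (by rw [← mgf, h]; exact hc.ne')
  have hm : MemLp (fun ω => Real.exp (t * X ω)) 2 P := by
    rw [memLp_two_iff_integrable_sq (by fun_prop)]
    simpa only [hsq] using hi
  refine ⟨hm, ?_⟩
  rw [eLpNorm_two_eq_ofReal_sqrt hm]
  simp_rw [hsq]
  rw [← h, mgf]

/-- The exponentials of the partial sums are bounded in `L²`, by the formula at `2 * t`; this
doubling is why `1 / 8` replaces `1 / 4`. With `abs_exp_sub_exp_le` and Hölder, `L²` convergence of
the sums becomes `L¹` convergence of the exponentials. -/
theorem IsSecondChaosSeries.mgf_eq (hF : IsSecondChaosSeries F α N P)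
    (hN : IsStdGaussianFamily N P) {A t : ℝ} (hα : HasSum (fun k => α k ^ 2) A)
    (ht : |t| * √A ≤ 1 / 8) : mgf F P t = Real.exp (∑' k, chiSqCgf (t * α k)) := by
  have := hN.indep.isProbabilityMeasure
  set S : ℕ → Ω → ℝ := fun m ω => ∑ k ∈ Finset.range m, α k * (N k ω ^ 2 - 1) with hS
  have hSm : ∀ m, MemLp (S m) 2 P := fun m => hN.memLp_sum α _
  have hlt : ∀ k, |t * α k| ≤ 1 / 8 := fun k => by
    rw [abs_mul]
    exact (mul_le_mul_of_nonneg_left (abs_le_sqrt_of_hasSum_sq hα k) (abs_nonneg t)).trans ht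
  have hmgf : ∀ m, mgf (S m) P t = Real.exp (∑ k ∈ Finset.range m, chiSqCgf (t * α k)) := fun m =>
    hN.mgf_sum fun k _ => by linarith [le_abs_self (t * α k), hlt k]
  have hmgf2 : ∀ m, mgf (S m) P (2 * t) =
      Real.exp (∑ k ∈ Finset.range m, chiSqCgf (2 * t * α k)) := fun m =>
    hN.mgf_sum fun k _ => by linarith [le_abs_self (t * α k), hlt k]
  have h1 := (hasSum_chiSqCgf (t := t) hα (by linarith)).1.hasSum.tendsto_sum_nat
  have h2 := (hasSum_chiSqCgf (t := 2 * t) hα (by rw [abs_mul, abs_two]; linarith)).1.hasSum.tendsto_sum_nat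
  obtain ⟨M, hM⟩ := h2.bddAbove_range
  have hM' : ∀ m, ∑ k ∈ Finset.range m, chiSqCgf (2 * t * α k) ≤ M := fun m => hM ⟨m, rfl⟩
  set B : ℝ≥0∞ := ENNReal.ofReal √(Real.exp M) with hB
  have hES : ∀ m, MemLp (fun ω => Real.exp (t * S m ω)) 2 P ∧
      eLpNorm (fun ω => Real.exp (t * S m ω)) 2 P ≤ B := fun m => by
    obtain ⟨h, h'⟩ := memLp_exp_of_mgf (hSm m).aestronglyMeasurable (hmgf2 m) (Real.exp_pos _)
    refine ⟨h, h'.le.trans ?_⟩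
    rw [hB]
    gcongr
    exact hM' m
  have hSF : Tendsto (fun m => eLpNorm (S m - F) 2 P) atTop (𝓝 0) :=
    hF.tendsto.congr fun m => by
      rw [← eLpNorm_neg]
      congr 1
      ext ω
      simp [hS]
  have hmeasF := hF.memLp.aestronglyMeasurable
  obtain ⟨ns, hns, hae⟩ := (tendstoInMeasure_of_tendsto_eLpNorm two_ne_zero
    (fun m => (hSm m).aestronglyMeasurable) hmeasF hSF).exists_seq_tendsto_ae
  -- Fatou along an almost surely convergent subsequence.
  have hEF : eLpNorm (fun ω => Real.exp (t * F ω)) 2 P ≤ B := by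
    refine (Lp.eLpNorm_lim_le_liminf_eLpNorm (f := fun i ω => Real.exp (t * S (ns i) ω))
      (fun i => (hES (ns i)).1.aestronglyMeasurable) _ ?_).trans ?_
    · filter_upwards [hae] with ω hω
      exact (Real.continuous_exp.tendsto _).comp (hω.const_mul t)
    · refine (liminf_le_liminf (Eventually.of_forall fun i => (hES (ns i)).2)).trans ?_
      simp
  have hEFm : MemLp (fun ω => Real.exp (t * F ω)) 2 P :=
    ⟨by fun_prop, hEF.trans_lt ENNReal.ofReal_lt_top⟩
  have hL1 : Tendsto (fun m => eLpNorm ((fun ω => Real.exp (t * S m ω)) -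
      fun ω => Real.exp (t * F ω)) 1 P) atTop (𝓝 0) := by
    have hlim : Tendsto (fun m => ‖t‖₊ * eLpNorm (S m - F) 2 P * (B + B)) atTop (𝓝 0) := by
      have := ENNReal.Tendsto.mul_const (ENNReal.Tendsto.const_mul hSF (a := (‖t‖₊ : ℝ≥0∞))
        (Or.inr ENNReal.coe_ne_top)) (b := B + B) (Or.inr (by simp [hB]))
      simpa using this
    refine tendsto_of_tendsto_of_tendsto_of_le_of_le tendsto_const_nhds hlim (fun _ => zero_le)
      fun m => ?_
    have hadd : eLpNorm ((fun ω => Real.exp (t * S m ω)) + fun ω => Real.exp (t * F ω)) 2 P ≤ B + B :=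
      (eLpNorm_add_le (hES m).1.aestronglyMeasurable hEFm.aestronglyMeasurable one_le_two).trans
        (add_le_add (hES m).2 hEF)
    have hmul := eLpNorm_le_eLpNorm_mul_eLpNorm_of_nnnorm (p := 2) (q := 2) (r := 1) (μ := P)
      ((hSm m).sub hF.memLp).aestronglyMeasurable
      ((hES m).1.add hEFm).aestronglyMeasurable (fun x y : ℝ => t * x * y) ‖t‖₊
      (Eventually.of_forall fun ω => by simp [nnnorm_mul])
    refine (eLpNorm_mono fun ω => ?_).trans (hmul.trans (by gcongr))
    simp only [Pi.sub_apply, Pi.add_apply, Real.norm_eq_abs]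
    refine (abs_exp_sub_exp_le _ _).trans (le_of_eq ?_)
    rw [abs_mul _ (_ + _), ← mul_sub, abs_of_pos (add_pos (Real.exp_pos _) (Real.exp_pos _))]
  have h3 := tendsto_integral_of_L1' _ hEFm.aestronglyMeasurable
    (Eventually.of_forall fun m => (hES m).1.integrable one_le_two) hL1
  refine tendsto_nhds_unique h3 ?_
  have h4 := (Real.continuous_exp.tendsto _).comp h1
  refine h4.congr fun m => ?_
  rw [Function.comp_apply, ← hmgf m, mgf]

theorem IsSecondChaosSeries.cumulant_eq (hF : IsSecondChaosSeries F α N P)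
    (hN : IsStdGaussianFamily N P) (r : ℕ) :
    cumulant r F P = r.factorial * chiSqCoeff r * ∑' k, α k ^ r := by
  have hα := hF.hasSum_sq hN
  set A := (∫ ω, F ω ^ 2 ∂P) / 2
  have hev : ∀ᶠ t : ℝ in 𝓝 0, |t| * √A < 1 / 8 := by
    have : Tendsto (fun t : ℝ => |t| * √A) (𝓝 0) (𝓝 (|0| * √A)) :=
      Continuous.tendsto (by fun_prop) 0
    exact this.eventually_lt_const (by simp)
  have hps : HasFPowerSeriesAt (cgf F P)
      (FormalMultilinearSeries.ofScalars ℝ fun r => chiSqCoeff r * ∑' k, α k ^ r) 0 := by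
    rw [hasFPowerSeriesAt_iff]
    filter_upwards [hev] with t ht
    rw [zero_add, cgf, hF.mgf_eq hN hα ht.le, Real.log_exp]
    simpa using (hasSum_chiSqCgf hα (by linarith)).2
  -- Uniqueness of the power series at `0` identifies its coefficients with the Taylor coefficients.
  have h := congrArg (fun p => FormalMultilinearSeries.coeff p r)
    (hps.analyticAt.hasFPowerSeriesAt.eq_formalMultilinearSeries hps)
  simp only [FormalMultilinearSeries.coeff_ofScalars] at h
  rw [cumulant, mul_assoc, ← h, mul_div_cancel₀]
  exact_mod_cast r.factorial_ne_zero

end Mgf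

/-- This factor is `2 ^ (r - 1) * (r - 1)!`; being at least `1`, it lets cumulant differences
dominate power sum differences. -/
theorem one_le_factorial_mul_chiSqCoeff {r : ℕ} (hr : 2 ≤ r) : 1 ≤ r.factorial * chiSqCoeff r := by
  rw [chiSqCoeff, if_neg (by omega)]
  have h1 : (1 : ℝ) ≤ 2 ^ (r - 1) := one_le_pow₀ one_le_two
  have h2 : (r : ℝ) ≤ r.factorial := by exact_mod_cast r.self_le_factorial
  have h3 : (0 : ℝ) < r := by positivity
  rw [mul_div_assoc', le_div_iff₀ h3]
  nlinarith

theorem cgf_eq_of_map_eq {Ω Ω' : Type*} [MeasurableSpace Ω] [MeasurableSpace Ω'] {P : Measure Ω}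
    {P' : Measure Ω'} {X : Ω → ℝ} {Y : Ω' → ℝ} (hX : AEMeasurable X P) (hY : AEMeasurable Y P')
    (h : P.map X = P'.map Y) : cgf X P = cgf Y P' := by
  funext t
  rw [cgf, cgf, ← mgf_id_map hX, ← mgf_id_map hY, h]

/-! ### Comparison with the target and conclusion. -/

section Target

variable {Ω Ω' : Type*} [MeasurableSpace Ω] [MeasurableSpace Ω'] {P : Measure Ω} {P' : Measure Ω'}
  {N : ℕ → Ω → ℝ} {q : ℕ} {N' : Fin q → Ω' → ℝ} {F : Ω → ℝ} {α : ℕ → ℝ}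

theorem IsStdGaussianFamily.map_embedding_eq (hN : IsStdGaussianFamily N P)
    (hN' : IsStdGaussianFamily N' P') (a : Fin q → ℝ) (k : Fin q ↪ ℕ) :
    P.map (fun ω => ∑ r, a r * (N (k r) ω ^ 2 - 1)) =
      P'.map (fun ω => ∑ r, a r * (N' r ω ^ 2 - 1)) := by
  rw [(hN.comp_embedding k).map_sum a, hN'.map_sum a]

theorem IsStdGaussianFamily.cumulant_sum (hN : IsStdGaussianFamily N P)
    (hN' : IsStdGaussianFamily N' P') (a : Fin q → ℝ) {r : ℕ} (hr : r ≠ 0) :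
    cumulant r (fun ω => ∑ i, a i * (N' i ω ^ 2 - 1)) P' =
      r.factorial * chiSqCoeff r * ∑ i, a i ^ r := by
  have hG := hN.isSecondChaosSeries_sum a Fin.valEmbedding
  rw [cumulant, ← cgf_eq_of_map_eq hG.memLp.aestronglyMeasurable.aemeasurable
    (hN'.memLp_sum a Finset.univ).aestronglyMeasurable.aemeasurable
    (hN.map_embedding_eq hN' a Fin.valEmbedding), ← cumulant, hG.cumulant_eq hN,
    (hasSum_extend_pow Fin.valEmbedding a hr).tsum_eq]

theorem IsSecondChaosSeries.wassersteinDist_le (hF : IsSecondChaosSeries F α N P)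
    (hN : IsStdGaussianFamily N P) (hN' : IsStdGaussianFamily N' P') (a : Fin q → ℝ)
    (k : Fin q ↪ ℕ) :
    wassersteinDist 2 (P.map F) (P'.map fun ω => ∑ r, a r * (N' r ω ^ 2 - 1)) ≤
      ENNReal.ofReal (√2 * √(∑' i, (α i - Function.extend k a 0 i) ^ 2)) := by
  rw [← hN.map_embedding_eq hN' a k, ← Real.sqrt_mul zero_le_two, ← hF.integral_sub_sq hN a k]
  exact wassersteinDist_two_map_le hF.memLp (hN.isSecondChaosSeries_sum a k).memLp

theorem IsSecondChaosSeries.hasSum_sq_of_integral_eq (hF : IsSecondChaosSeries F α N P)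
    (hN : IsStdGaussianFamily N P) (hN' : IsStdGaussianFamily N' P') (a : Fin q → ℝ)
    (h : ∫ ω, F ω ^ 2 ∂P = ∫ ω, (∑ r, a r * (N' r ω ^ 2 - 1)) ^ 2 ∂P') :
    HasSum (fun k => α k ^ 2) (∑ r, a r ^ 2) := by
  have := hF.hasSum_sq hN
  rwa [h, hN'.integral_sum_sq, mul_div_cancel_left₀ _ two_ne_zero] at this

theorem IsSecondChaosSeries.abs_tsum_pow_sub_le_abs_cumulant_sub
    (hF : IsSecondChaosSeries F α N P) (hN : IsStdGaussianFamily N P)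
    (hN' : IsStdGaussianFamily N' P') (a : Fin q → ℝ) {r : ℕ} (hr : 2 ≤ r) :
    |∑' i, α i ^ r - ∑ i, a i ^ r| ≤
      |cumulant r F P - cumulant r (fun ω => ∑ i, a i * (N' i ω ^ 2 - 1)) P'| := by
  have h1 := one_le_factorial_mul_chiSqCoeff hr
  rw [hF.cumulant_eq hN, hN.cumulant_sum hN' a (by omega), ← mul_sub, abs_mul]
  exact le_mul_of_one_le_left (abs_nonneg _) (h1.trans (le_abs_self _))

end Target

/-- A Slutsky argument: `G n` has exactly the law of the target, and `F n - G n` tends to `0` in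
`L²`. -/
theorem tendstoInDistribution_of_sqrt_le {Ω Ω' : Type*} [MeasurableSpace Ω] [MeasurableSpace Ω']
    {P : Measure Ω} [IsProbabilityMeasure P] {P' : Measure Ω'} [IsProbabilityMeasure P']
    {N : ℕ → ℕ → Ω → ℝ} {q : ℕ} {N' : Fin q → Ω' → ℝ} {F : ℕ → Ω → ℝ} {α : ℕ → ℕ → ℝ}
    (hF : ∀ n, IsSecondChaosSeries (F n) (α n) (N n) P) (hN : ∀ n, IsStdGaussianFamily (N n) P)
    (hN' : IsStdGaussianFamily N' P') (a : Fin q → ℝ) (k : ℕ → Fin q ↪ ℕ)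
    (h : Tendsto (fun n => √(∑' i, (α n i - Function.extend (k n) a 0 i) ^ 2)) atTop (𝓝 0)) :
    TendstoInDistribution F atTop (fun ω => ∑ r, a r * (N' r ω ^ 2 - 1)) (fun _ => P) P' := by
  set G : ℕ → Ω → ℝ := fun n ω => ∑ r, a r * (N n (k n r) ω ^ 2 - 1)
  have hG : ∀ n, MemLp (G n) 2 P := fun n => ((hN n).isSecondChaosSeries_sum a (k n)).memLp
  have hGdist : TendstoInDistribution G atTop (fun ω => ∑ r, a r * (N' r ω ^ 2 - 1))
      (fun _ => P) P' := by
    refine ⟨fun n => (hG n).aestronglyMeasurable.aemeasurable,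
      (hN'.memLp_sum a Finset.univ).aestronglyMeasurable.aemeasurable, ?_⟩
    refine tendsto_const_nhds.congr fun n => ?_
    exact Subtype.ext ((hN n).map_embedding_eq hN' a (k n)).symm
  refine tendstoInDistribution_of_tendstoInMeasure_sub F _ hGdist ?_
    fun n => (hF n).memLp.aestronglyMeasurable.aemeasurable
  refine tendstoInMeasure_of_tendsto_eLpNorm two_ne_zero
    (fun n => ((hF n).memLp.sub (hG n)).aestronglyMeasurable) aestronglyMeasurable_const ?_
  have hlim := ENNReal.tendsto_ofReal (h.const_mul √2)
  rw [mul_zero, ENNReal.ofReal_zero] at hlim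
  refine hlim.congr fun n => ?_
  rw [← Real.sqrt_mul zero_le_two, ← (hF n).integral_sub_sq (hN n) a (k n),
    ← eLpNorm_two_eq_ofReal_sqrt (f := fun ω => F n ω - G n ω) ((hF n).memLp.sub (hG n))]
  congr 1
  ext ω
  simp

theorem corollary3p8 (q : ℕ) (hq : 2 ≤ q) (a : Fin q → ℝ) (ha0 : ∀ i, a i ≠ 0)
    (ha : Function.Injective a) :
    ∃ C : ℝ, 0 < C ∧
      ∀ (Ω : Type*) [MeasurableSpace Ω] (P : Measure Ω) [IsProbabilityMeasure P]
        (N : ℕ → ℕ → Ω → ℝ) (α : ℕ → ℕ → ℝ) (F : ℕ → Ω → ℝ)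
        (Ω' : Type*) [MeasurableSpace Ω'] (P' : Measure Ω') [IsProbabilityMeasure P']
        (N' : Fin q → Ω' → ℝ) (Finf : Ω' → ℝ),
        -- the approximating sequence `F n = ∑ₖ α n k * ((N n k)² - 1)`
        (∀ n, IsStdGaussianFamily (N n) P) →
        (∀ n, IsSecondChaosSeries (F n) (α n) (N n) P) →
        -- the target `Finf = ∑ᵢ a i * ((N' i)² - 1)`
        IsStdGaussianFamily N' P' →
        (∀ ω, Finf ω = ∑ i, a i * (N' i ω ^ 2 - 1)) →
        -- normalization
        (∀ n, ∫ ω, F n ω ^ 2 ∂P = ∫ ω, Finf ω ^ 2 ∂P') →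
        -- (a)
        (∀ n, wassersteinDist 2 (P.map (F n)) (P'.map Finf) ≤
          ENNReal.ofReal (C * (√(chaosDelta a (α n)) +
            ∑ r ∈ Finset.Icc 2 (q + 1), |cumulant r (F n) P - cumulant r Finf P'|))) ∧
        -- (b)
        (Module.finrank ℚ (Submodule.span ℚ (Set.range fun i => a i ^ 2)) = q →
          (∀ n, wassersteinDist 2 (P.map (F n)) (P'.map Finf) ≤
            ENNReal.ofReal (C * √(chaosDelta a (α n)))) ∧
          chaosDelta a a = 0 ∧
          (Tendsto (fun n => chaosDelta a (α n)) atTop (𝓝 (chaosDelta a a)) →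
            TendstoInDistribution F atTop Finf (fun _ => P) P')) := by
  obtain ⟨C₁, hC₁, h₁⟩ := exists_embedding_sqrt_le ha0 ha (Finset.Icc 2 (q + 1))
    (fun j hj => (Finset.mem_Icc.1 hj).1) (eq_zero_of_forall_sum_mul_pow_eq_zero ha0 ha)
  -- The rank condition stands inside the existential, since one constant must serve (a)
  -- unconditionally and (b) under that condition.
  obtain ⟨C₂, hC₂, h₂⟩ : ∃ C > 0,
      Module.finrank ℚ (Submodule.span ℚ (Set.range fun i => a i ^ 2)) = q →
      ∀ α : ℕ → ℝ, HasSum (fun k => α k ^ 2) (∑ r, a r ^ 2) →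
        ∃ k : Fin q ↪ ℕ, √(∑' i, (α i - Function.extend k a 0 i) ^ 2) ≤ C * √(chaosDelta a α) := by
    by_cases hb : Module.finrank ℚ (Submodule.span ℚ (Set.range fun i => a i ^ 2)) = q
    · obtain ⟨C, hC, h⟩ := exists_embedding_sqrt_le ha0 ha {2} (by simp)
        fun m hm => eq_zero_of_sum_mul_sq_eq_zero hb m (hm 2 (by simp))
      refine ⟨C, hC, fun _ α hα => ?_⟩
      -- For `J = {2}` the only power sum difference vanishes by the normalization.
      simpa [hα.tsum_eq] using h α hα
    · exact ⟨1, one_pos, fun h => absurd h hb⟩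
  refine ⟨√2 * (C₁ + C₂), by positivity, ?_⟩
  intro Ω _ P _ N α F Ω' _ P' _ N' Finf hN hF hN' hFinf hnorm
  obtain rfl : Finf = fun ω => ∑ i, a i * (N' i ω ^ 2 - 1) := funext hFinf
  have hα := fun n => (hF n).hasSum_sq_of_integral_eq (hN n) hN' a (hnorm n)
  refine ⟨fun n => ?_, fun hb => ⟨fun n => ?_, chaosDelta_self a, fun hΔ => ?_⟩⟩
  · obtain ⟨k, hk⟩ := h₁ _ (hα n)
    refine ((hF n).wassersteinDist_le (hN n) hN' a k).trans (ENNReal.ofReal_le_ofReal ?_)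
    rw [mul_assoc]
    refine mul_le_mul_of_nonneg_left (hk.trans ?_) (Real.sqrt_nonneg _)
    refine mul_le_mul (le_add_of_nonneg_right hC₂.le) ?_ (by positivity) (by positivity)
    refine add_le_add le_rfl (Finset.sum_le_sum fun r hr => ?_)
    exact (hF n).abs_tsum_pow_sub_le_abs_cumulant_sub (hN n) hN' a (Finset.mem_Icc.1 hr).1
  · obtain ⟨k, hk⟩ := h₂ hb _ (hα n)
    refine ((hF n).wassersteinDist_le (hN n) hN' a k).trans (ENNReal.ofReal_le_ofReal ?_)
    rw [mul_assoc]
    refine mul_le_mul_of_nonneg_left (hk.trans ?_) (Real.sqrt_nonneg _)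
    exact mul_le_mul_of_nonneg_right (le_add_of_nonneg_left hC₁.le) (Real.sqrt_nonneg _)
  · choose k hk using fun n => h₂ hb _ (hα n)
    refine tendstoInDistribution_of_sqrt_le hF hN hN' a k ?_
    have hlim := (hΔ.sqrt).const_mul C₂
    rw [chaosDelta_self, Real.sqrt_zero, mul_zero] at hlim
    exact squeeze_zero (fun n => Real.sqrt_nonneg _) hk hlim
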